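/- Consider a synchronous message-passing system of $n$ processes with distinct known identifiers, fully connected by authenticated channels. In each round every process sends messages to the other processes and then receives all messages sent to it in that round. Correct processes follow the algorithm, which is deterministic and may depend on $n$, $f$ and on the semilattice and proposal set below. At most $f$ processes are Byzantine: they deviate arbitrarily and may cooperate. The system has authenticated messages: every process can sign messages, everyone can verify signatures, and nobody can forge a signature of a correct process (signatures are ideal). Let $(V,\oplus)$ be a join semilattice, with $u\le v \iff v=u\oplus v$, and let $E\subseteq V$ be a set of allowed proposals. Each correct process $p_i$ starts with a proposal $pro_i\in E$. A Byzantine lattice agreement algorithm tolerating $f$ Byzantine processes guarantees, in every execution with at most $f$ Byzantine processes, where $C$ is the set of correct processes: - Liveness and stability: each $p_i\in C$ outputs exactly one decision value $dec_i\in V$. - Comparability: for all $p_i,p_j\in C$, $dec_i\le dec_j$ or $dec_j\le dec_i$. - Inclusivity: $pro_i\le dec_i$ for every $p_i\in C$. - Non-triviality: there is $B\subseteq E$ with $|B|\le f$ such that $dec_i\le\bigoplus(\{pro_j : p_j\in C\}\cup B)$ for every $p_i\in C$. It terminates in $R$ rounds if, in every such execution, every correct process has output its decision by the end of round $R$ and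 sends no messages afterwards. **Theorem.** There is a function $T:\mathbb N\to\mathbb N$ with $T(f)=O(\log f)$ as $f\to\infty$ such that for all $n,f\in\mathbb N$ with $n\ge 3f+1$, every join semilattice $(V,\oplus)$ and every $E\subseteq V$, there is a Byzantine lattice agreement algorithm for $n$ processes on $(V,\oplus)$ with allowed proposals $E$ that tolerates $f$ Byzantine processes and terminates in $T(f)$ rounds in the authenticated message model. -/

import Mathlib

universe u

/-- Messages exchanged by `n` processes, as terms with ideal digital signatures. Messages are built
from numbers and values of `V` by pairing and signing; `signed i m` is the message `m` together with
a valid signature of `m` by process `i`, which everybody can verify and read. -/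
inductive AuthMsg (n : ℕ) (V : Type u) : Type u
  | num (k : ℕ) : AuthMsg n V
  | val (v : V) : AuthMsg n V
  | pair (a b : AuthMsg n V) : AuthMsg n V
  | signed (i : Fin n) (m : AuthMsg n V) : AuthMsg n V

/-- `CanProduce S K m`: somebody who owns the signing keys of the processes in `S`, and of nobody
else, and who has seen the messages in `K`, is able to produce the message `m`. Numbers, values,
pairs and parts of known messages are free; a new signature can be made only with a key from `S`. -/
inductive CanProduce {n : ℕ} {V : Type u} (S : Set (Fin n)) (K : Set (AuthMsg n V)) :
    AuthMsg n V → Prop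
  | known {m : AuthMsg n V} : m ∈ K → CanProduce S K m
  | num (k : ℕ) : CanProduce S K (.num k)
  | val (v : V) : CanProduce S K (.val v)
  | pair {a b : AuthMsg n V} : CanProduce S K a → CanProduce S K b → CanProduce S K (.pair a b)
  | fst {a b : AuthMsg n V} : CanProduce S K (.pair a b) → CanProduce S K a
  | snd {a b : AuthMsg n V} : CanProduce S K (.pair a b) → CanProduce S K b
  | sign {i : Fin n} {m : AuthMsg n V} : i ∈ S → CanProduce S K m → CanProduce S K (.signed i m)
  | content {i : Fin n} {m : AuthMsg n V} : CanProduce S K (.signed i m) → CanProduce S K m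

/-- What a process has received so far: the `r`-th entry tells, for each process `j`, the (finite,
possibly empty) list of messages received from `j` in round `r`. The receiver knows the sender
of every message (authenticated channels). -/
abbrev LocalHistory (n : ℕ) (V : Type u) : Type u := List (Fin n → List (AuthMsg n V))

/-- The set of all messages contained in a local history. -/
def LocalHistory.messages {n : ℕ} {V : Type u} (h : LocalHistory n V) : Set (AuthMsg n V) :=
  {m | ∃ rcv ∈ h, ∃ j, m ∈ rcv j}

/-- A deterministic synchronous algorithm for `n` processes with proposals and decisions in `V`,
in the authenticated message model. -/
structure SyncAlgorithm (n : ℕ) (V : Type u) where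
  /-- `send i x h j`: what process `i` with proposal `x` sends to process `j` in the round after
  the history `h`. -/
  send : Fin n → V → LocalHistory n V → Fin n → List (AuthMsg n V)
  /-- `output i x h`: the decision (if any) that process `i` with proposal `x` outputs at the end of
  the last round of the history `h`. -/
  output : Fin n → V → LocalHistory n V → Option V
  /-- A process signs with its own key only; signatures of others must have been received. -/
  send_producible : ∀ (i : Fin n) (x : V) (h : LocalHistory n V) (j : Fin n),
    ∀ m ∈ send i x h j, CanProduce {i} h.messages m

/-- The traffic of an execution: `t r i j` is the list of messages sent by `i` to `j` in round `r`
(rounds are numbered from `0`); all of them are received by `j` in the same round. -/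
abbrev Traffic (n : ℕ) (V : Type u) : Type u := ℕ → Fin n → Fin n → List (AuthMsg n V)

/-- The local history of process `i` after the first `r` rounds. -/
def Traffic.history {n : ℕ} {V : Type u} (t : Traffic n V) (i : Fin n) (r : ℕ) :
    LocalHistory n V :=
  (List.range r).map fun k j => t k j i

/-- The traffic `t` can occur when the processes in `F` are Byzantine and the other processes follow
the algorithm `A` with proposals `x`. The Byzantine processes act in arbitrary ways, may
cooperate, and may see everything the correct processes send, in the current round too; they only
cannot forge signatures of correct processes. -/
structure IsExecution {n : ℕ} {V : Type u} (A : SyncAlgorithm n V) (F : Finset (Fin n))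
    (x : Fin n → V) (t : Traffic n V) : Prop where
  correct : ∀ (r : ℕ) (i : Fin n), i ∉ F → ∀ j : Fin n,
    t r i j = A.send i (x i) (t.history i r) j
  byzantine : ∀ (r : ℕ) (i : Fin n), i ∈ F → ∀ j : Fin n, ∀ m ∈ t r i j,
    CanProduce (F : Set (Fin n)) {m' | ∃ s ≤ r, ∃ k, k ∉ F ∧ ∃ l, m' ∈ t s k l} m

/-- The decisions `dec` fulfil the requirements of Byzantine lattice agreement, with `f` as the
maximal number of foreign values, when the processes outside `F` are correct and propose `x`. -/
structure IsLatticeAgreement {n : ℕ} {V : Type u} [SemilatticeSup V] (E : Set V) (f : ℕ)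
    (F : Finset (Fin n)) (x dec : Fin n → V) : Prop where
  comparability : ∀ i j : Fin n, i ∉ F → j ∉ F → dec i ≤ dec j ∨ dec j ≤ dec i
  inclusivity : ∀ i : Fin n, i ∉ F → x i ≤ dec i
  nonTriviality : ∃ B : Finset V, (B : Set V) ⊆ E ∧ B.card ≤ f ∧
    ∃ s : V, IsLUB ({v | ∃ i, i ∉ F ∧ x i = v} ∪ (B : Set V)) s ∧ ∀ i : Fin n, i ∉ F → dec i ≤ s

/-- `A` is a Byzantine lattice agreement algorithm for the join semilattice `V` and the set `E` of
allowed proposals that tolerates `f` Byzantine processes and terminates in `R` rounds: in every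
execution each correct process outputs a decision by the end of round `R`, never outputs another
one, and sends nothing after `R` rounds, and the decisions fulfil the requirements of
lattice agreement. -/
def SolvesByzantineLA {n : ℕ} {V : Type u} [SemilatticeSup V] (A : SyncAlgorithm n V)
    (E : Set V) (f R : ℕ) : Prop :=
  ∀ F : Finset (Fin n), F.card ≤ f →
    ∀ x : Fin n → V, (∀ i, i ∉ F → x i ∈ E) →
      ∀ t : Traffic n V, IsExecution A F x t →
        (∀ r, R ≤ r → ∀ i, i ∉ F → ∀ j, t r i j = []) ∧
        ∃ dec : Fin n → V,
          (∀ i, i ∉ F → ∃ r ≤ R, A.output i (x i) (t.history i r) = some (dec i)) ∧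
          (∀ i, i ∉ F → ∀ r v, A.output i (x i) (t.history i r) = some v → v = dec i) ∧
          IsLatticeAgreement E f F x dec

/-! Processes accumulate sets of pairs (proposer, value) and decide the join, so it is enough that
the final sets of the correct processes form a chain. An initial broadcast with echoes admits at
most one value per proposer and leaves each correct process with between `n - f` and `n` pairs. The
classifier bisects this range of sizes. At level `l`, correct members of group `c` hold more than `n
- f - 1 + c * 2 ^ (L - l)` pairs, while at most `n - f - 1 + (c + 1) * 2 ^ (L - l)` pairs are
admissible in the group. Members compare the number of pairs seen with the midpoint. Whatever is
admissible in the lower half was seen by every member (`admissible_lower_subset`): it is few if a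
correct member moves down, and it is contained in the set of every correct member that moves up.
Thus `invariant_succ` holds. Since `f < 2 ^ L`, after `L` levels a single size is left per group:
members of one group hold the same set, and the sets of different groups are nested
(`own_subset_of_code_le`). -/

namespace ByzantineLA

open Finset

/-! ### Encoding of messages and counting of senders. -/

variable {n : ℕ} {V : Type u}

/-- The messages used by the algorithm: the proposal `p.2.2` of process `p.2.1`, labelled with the
group code `p.1`. -/
def pack (p : ℕ × Fin n × V) : AuthMsg n V :=
  .pair (.num p.1) (.pair (.num p.2.1) (.val p.2.2))

theorem pack_injective : Function.Injective (pack : ℕ × Fin n × V → AuthMsg n V) := by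
  rintro ⟨a, b, c⟩ ⟨a', b', c'⟩ h
  simp only [pack, AuthMsg.pair.injEq, AuthMsg.num.injEq, AuthMsg.val.injEq] at h
  obtain ⟨rfl, h, rfl⟩ := h
  rw [Fin.ext h]

theorem canProduce_pack (S : Set (Fin n)) (K : Set (AuthMsg n V)) (p : ℕ × Fin n × V) :
    CanProduce S K (pack p) :=
  .pair (.num _) (.pair (.num _) (.val _))

/-- The messages received in one round, by sender. -/
abbrev Inbox (n : ℕ) (V : Type u) : Type u := Fin n → List (AuthMsg n V)

open Classical in
/-- The processes from which `p` was received. -/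
noncomputable def senders (I : Inbox n V) (p : ℕ × Fin n × V) : Finset (Fin n) :=
  {j | pack p ∈ I j}

@[simp]
theorem mem_senders {I : Inbox n V} {p : ℕ × Fin n × V} {j : Fin n} :
    j ∈ senders I p ↔ pack p ∈ I j := by
  simp [senders]

theorem finite_received (I : Inbox n V) : {p : ℕ × Fin n × V | ∃ j, pack p ∈ I j}.Finite := by
  have h : (⋃ j, {m | m ∈ I j}).Finite := Set.finite_iUnion fun j => List.finite_toSet (I j)
  refine (h.preimage pack_injective.injOn).subset ?_
  rintro p ⟨j, hj⟩
  exact Set.mem_iUnion.2 ⟨j, hj⟩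

theorem finite_le_card_senders (I : Inbox n V) {k : ℕ} (hk : 0 < k) :
    {p : ℕ × Fin n × V | k ≤ #(senders I p)}.Finite := by
  refine (finite_received I).subset fun p hp => ?_
  obtain ⟨j, hj⟩ := card_pos.1 (hk.trans_le hp)
  exact ⟨j, mem_senders.1 hj⟩

theorem finite_le_card_senders_code (I : Inbox n V) {k : ℕ} (hk : 0 < k) (c : ℕ) :
    {e : Fin n × V | k ≤ #(senders I (c, e))}.Finite :=
  (finite_le_card_senders I hk).preimage (f := fun e => (c, e))
    (Function.Injective.injOn fun _ _ h => (Prod.ext_iff.1 h).2)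

/-! ### States and the classifier. -/

/-- The state of a process between two levels: for each group the proposals admissible in it, the
group of the process, and the proposals accumulated so far. -/
structure State (n : ℕ) (V : Type u) where
  legit : ℕ → Set (Fin n × V)
  code : ℕ
  own : Set (Fin n × V)

/-- The state after the three rounds (proposal, echo, ready) of the initial broadcast. -/
def firstState (f : ℕ) (readies : Inbox n V) : State n V where
  -- The group code plays no role here, so every chain of parent groups ends in the same admissible
  -- set.
  legit _ := {e | f + 1 ≤ #(senders readies (0, e))}
  code := 0
  own := {e | n - f ≤ #(senders readies (0, e))}

/-- The proposals seen by a process with state `s` in its group. -/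
def seen (f : ℕ) (s : State n V) (readies : Inbox n V) : Set (Fin n × V) :=
  {e | f + 1 ≤ #(senders readies (s.code, e))}

open Classical in
/-- The classifier: processes that have seen more than `m` proposals adopt all of them and move to
the upper half `2 * c + 1` of their group `c`, the others keep what they had and move to
the lower half `2 * c`. -/
noncomputable def nextState (f m : ℕ) (s : State n V) (relays readies : Inbox n V) : State n V where
  -- A quorum of readies guarantees that all correct members of the parent group saw the proposal.
  -- For the upper half `f + 1` relays suffice, so that whatever a member saw is admissible for
  -- everyone.
  legit c := if c % 2 = 1 then {e | f + 1 ≤ #(senders relays (c / 2, e))}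
    else {e | n - f ≤ #(senders readies (c / 2, e))}
  code := if (seen f s readies).ncard ≤ m then 2 * s.code else 2 * s.code + 1
  own := if (seen f s readies).ncard ≤ m then s.own else seen f s readies

/-- The state after `l` levels of a process that received `ρ r` in round `r`. -/
noncomputable def stateAt (f L : ℕ) (ρ : ℕ → Inbox n V) : ℕ → State n V
  | 0 => firstState f (ρ 2)
  -- The threshold is the midpoint of the size interval of the group.
  | l + 1 => nextState f (n - f - 1 + (2 * (stateAt f L ρ l).code + 1) * 2 ^ (L - (l + 1)))
      (stateAt f L ρ l) (ρ (3 * l + 4)) (ρ (3 * l + 5))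

/-- Causality: it lets the whole traffic replace the finite history available to a process. -/
theorem stateAt_congr (f L : ℕ) {ρ ρ' : ℕ → Inbox n V} (l : ℕ)
    (h : ∀ r < 3 * l + 3, ρ r = ρ' r) : stateAt f L ρ l = stateAt f L ρ' l := by
  induction l with
  | zero => simp only [stateAt, h 2 (by lia)]
  | succ l ih =>
    simp only [stateAt, ih fun r hr => h r (by lia), h (3 * l + 4) (by lia),
      h (3 * l + 5) (by lia)]

theorem finite_own_stateAt {f : ℕ} (hf : f < n) (L : ℕ) (ρ : ℕ → Inbox n V) (l : ℕ) :
    (stateAt f L ρ l).own.Finite := by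
  induction l with
  | zero => exact finite_le_card_senders_code _ (by lia) _
  | succ l ih =>
    simp only [stateAt, nextState]
    split_ifs
    · exact ih
    · exact finite_le_card_senders_code _ (by lia) _

/-! ### The algorithm. -/

/-- What process `i` with proposal `x` broadcasts in round `r` after having received `ρ`. -/
def outgoing (E : Set V) (f L : ℕ) (i : Fin n) (x : V) (ρ : ℕ → Inbox n V) (r : ℕ) :
    Set (ℕ × Fin n × V) :=
  if r = 0 then {(0, i, x)}
  else if r = 1 then {p | p.1 = 0 ∧ p.2.2 ∈ E ∧ pack p ∈ ρ 0 p.2.1 ∧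
    ∀ w, pack (0, p.2.1, w) ∈ ρ 0 p.2.1 → w = p.2.2}
  else if r % 3 = 0 then {p | p.1 = (stateAt f L ρ (r / 3 - 1)).code ∧
    p.2 ∈ (stateAt f L ρ (r / 3 - 1)).own}
  else if r % 3 = 1 then {p | p.2 ∈ (stateAt f L ρ (r / 3 - 1)).legit p.1 ∧
    ∃ j, pack p ∈ ρ (r - 1) j}
  else {p | n - f ≤ #(senders (ρ (r - 1)) p)}

theorem outgoing_congr (E : Set V) (f L : ℕ) (i : Fin n) (x : V) {ρ ρ' : ℕ → Inbox n V} (r : ℕ)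
    (h : ∀ k < r, ρ k = ρ' k) : outgoing E f L i x ρ r = outgoing E f L i x ρ' r := by
  unfold outgoing
  split_ifs with h0 h1 h2 h3
  · rfl
  · rw [h 0 (by lia)]
  · rw [stateAt_congr f L _ fun k hk => h k (by lia)]
  · rw [stateAt_congr f L _ fun k hk => h k (by lia), h (r - 1) (by lia)]
  · rw [h (r - 1) (by lia)]

theorem finite_outgoing (E : Set V) {f : ℕ} (hf : f < n) (L : ℕ) (i : Fin n) (x : V)
    (ρ : ℕ → Inbox n V) (r : ℕ) : (outgoing E f L i x ρ r).Finite := by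
  unfold outgoing
  split_ifs
  · exact Set.finite_singleton _
  · exact (finite_received (ρ 0)).subset fun p hp => ⟨_, hp.2.2.1⟩
  · exact ((Set.finite_singleton _).prod (finite_own_stateAt hf L ρ (r / 3 - 1))).subset
      fun p hp => ⟨hp.1, hp.2⟩
  · exact (finite_received (ρ (r - 1))).subset fun p hp => hp.2
  · exact finite_le_card_senders _ (by lia)

open Classical in
/-- The messages that encode the elements of a finite set. -/
noncomputable def packList (S : Set (ℕ × Fin n × V)) : List (AuthMsg n V) :=
  if h : S.Finite then h.toFinset.toList.map pack else []

theorem exists_of_mem_packList {S : Set (ℕ × Fin n × V)} {m : AuthMsg n V} (h : m ∈ packList S) :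
    ∃ p, pack p = m := by
  unfold packList at h
  split_ifs at h
  · obtain ⟨p, -, hp⟩ := List.mem_map.1 h
    exact ⟨p, hp⟩
  · simp at h

theorem pack_mem_packList {S : Set (ℕ × Fin n × V)} (h : S.Finite) {p : ℕ × Fin n × V} :
    pack p ∈ packList S ↔ p ∈ S := by
  simp [packList, h, pack_injective.eq_iff]

/-- The inboxes listed in a history. -/
def inboxes (h : LocalHistory n V) (r : ℕ) : Inbox n V := h.getD r fun _ => []

theorem inboxes_history (t : Traffic n V) (i : Fin n) {r k : ℕ} (h : k < r) :
    inboxes (t.history i r) k = fun j => t k j i := by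
  simp [inboxes, Traffic.history, List.getD, h]

open Classical in
/-- The least upper bound of a set of proposals, if it exists. -/
noncomputable def joinD [SemilatticeSup V] (S : Set (Fin n × V)) (x : V) : V :=
  -- The fallback `x` is never the decision of a correct process, whose final set is finite and
  -- contains its own proposal.
  if h : ∃ s, IsLUB (Prod.snd '' S) s then h.choose else x

theorem exists_isLUB [SemilatticeSup V] {S : Set V} (h : S.Finite) (hne : S.Nonempty) :
    ∃ s, IsLUB S s := by
  have := Finset.isLUB_sup' (s := h.toFinset) (by simpa using hne)
  exact ⟨_, by simpa using this⟩

theorem isLUB_joinD [SemilatticeSup V] {S : Set (Fin n × V)} (h : S.Finite) (hne : S.Nonempty)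
    (x : V) : IsLUB (Prod.snd '' S) (joinD S x) := by
  have h' := exists_isLUB (h.image Prod.snd) (hne.image _)
  rw [joinD, dif_pos h']
  exact h'.choose_spec

/-- The algorithm with `L` levels of classification, each of three rounds (send, relay, ready),
after an initial broadcast of three rounds. It relies on quorums of authenticated channels
only: no process ever signs a message. -/
noncomputable def algorithm [SemilatticeSup V] (n : ℕ) (E : Set V) (f L : ℕ) :
    SyncAlgorithm n V where
  send i x h _ := if h.length < 3 * (L + 1) then
    packList (outgoing E f L i x (inboxes h) h.length) else []
  output i x h := if h.length = 3 * (L + 1) then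
    some (joinD (stateAt f L (inboxes h) L).own x) else none
  send_producible i x h j m hm := by
    split_ifs at hm
    · obtain ⟨p, rfl⟩ := exists_of_mem_packList hm
      exact canProduce_pack _ _ p
    · simp at hm

/-! ### Runs and quorum counting. -/

/-- The correct processes (those outside `F`) broadcast as prescribed. -/
structure IsRun (E : Set V) (f L : ℕ) (F : Finset (Fin n)) (x : Fin n → V) (t : Traffic n V) :
    Prop where
  card_le : #F ≤ f
  lt_card : 3 * f < n
  proposal_mem : ∀ i ∉ F, x i ∈ E
  pack_mem : ∀ r < 3 * (L + 1), ∀ i ∉ F, ∀ j p, pack p ∈ t r i j ↔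
    p ∈ outgoing E f L i (x i) (fun k j => t k j i) r

theorem isRun_of_isExecution [SemilatticeSup V] {E : Set V} {f L : ℕ} {F : Finset (Fin n)}
    {x : Fin n → V} {t : Traffic n V} (hF : #F ≤ f) (hn : 3 * f < n) (hx : ∀ i, i ∉ F → x i ∈ E)
    (h : IsExecution (algorithm n E f L) F x t) : IsRun E f L F x t where
  card_le := hF
  lt_card := hn
  proposal_mem := hx
  pack_mem r hr i hi j p := by
    have hl : (t.history i r).length = r := by simp [Traffic.history]
    rw [h.correct r i hi j]
    simp only [algorithm, hl, if_pos hr]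
    rw [pack_mem_packList (finite_outgoing E (by lia) _ _ _ _ _),
      outgoing_congr E f L i (x i) r fun k hk => inboxes_history t i hk]

namespace IsRun

variable {E : Set V} {f L : ℕ} {F : Finset (Fin n)} {x : Fin n → V} {t : Traffic n V}

/-- The state of process `i` after `l` levels. -/
noncomputable def state (f L : ℕ) (t : Traffic n V) (i : Fin n) (l : ℕ) : State n V :=
  stateAt f L (fun k j => t k j i) l

/-- The processes from which `q` received `p` in round `r`. -/
noncomputable abbrev support (t : Traffic n V) (r : ℕ) (q : Fin n) (p : ℕ × Fin n × V) :
    Finset (Fin n) :=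
  senders (fun j => t r j q) p

/-- The proposals that some correct process considers admissible in group `c`. -/
def admissible (f L : ℕ) (F : Finset (Fin n)) (t : Traffic n V) (l c : ℕ) : Set (Fin n × V) :=
  {e | ∃ q ∉ F, e ∈ (state f L t q l).legit c}

section counting

variable (h : IsRun E f L F x t)
include h

theorem exists_correct {s : Finset (Fin n)} (hs : f + 1 ≤ #s) : ∃ j ∈ s, j ∉ F := by
  by_contra! hc
  have := card_le_card hc
  have := h.card_le
  lia

theorem le_card_of_correct {s : Finset (Fin n)} (hs : ∀ j, j ∉ F → j ∈ s) : n - f ≤ #s := by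
  have h1 : Fᶜ ⊆ s := fun j hj => hs j (by simpa using hj)
  have h2 := card_le_card h1
  rw [card_compl, Fintype.card_fin] at h2
  have := h.card_le
  lia

/-- Two quorums overlap in at least `n - 2 * f > f` processes. -/
theorem exists_correct_inter {s s' : Finset (Fin n)} (hs : n - f ≤ #s) (hs' : n - f ≤ #s') :
    ∃ j ∈ s ∩ s', j ∉ F := by
  apply h.exists_correct
  have h1 := card_union_add_card_inter s s'
  have h2 : #(s ∪ s') ≤ n := by simpa using card_le_univ (s ∪ s')
  have := h.lt_card
  lia

/-- What one process received from a quorum, all processes received from `f + 1` processes. -/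
theorem lt_card_support {r : ℕ} (hr : r < 3 * (L + 1)) {q : Fin n} (q' : Fin n)
    {p : ℕ × Fin n × V} (hs : n - f ≤ #(support t r q p)) : f + 1 ≤ #(support t r q' p) := by
  have h1 : support t r q p \ F ⊆ support t r q' p := by
    intro j hj
    simp only [mem_sdiff, mem_senders] at hj ⊢
    rw [h.pack_mem r hr j hj.2] at hj ⊢
    exact hj.1
  have h2 := card_le_card h1
  have h3 := le_card_sdiff F (support t r q p)
  have := h.card_le
  have := h.lt_card
  lia

theorem pack_mem_ready {l : ℕ} (hl : l < L + 1) {i : Fin n} (hi : i ∉ F) (j : Fin n)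
    (p : ℕ × Fin n × V) :
    pack p ∈ t (3 * l + 2) i j ↔ n - f ≤ #(support t (3 * l + 1) i p) := by
  rw [h.pack_mem _ (by lia) i hi]
  simp [outgoing]

theorem pack_mem_relay {l : ℕ} (hl : l < L) {i : Fin n} (hi : i ∉ F) (j : Fin n)
    (p : ℕ × Fin n × V) :
    pack p ∈ t (3 * l + 4) i j ↔
      p.2 ∈ (state f L t i l).legit p.1 ∧ ∃ k, pack p ∈ t (3 * l + 3) k i := by
  rw [h.pack_mem _ (by lia) i hi]
  have h1 : (3 * l + 4) / 3 - 1 = l := by lia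
  have h2 : (3 * l + 4) % 3 = 1 := by lia
  simp [outgoing, h1, h2, state]

theorem pack_mem_own {l : ℕ} (hl : l < L) {i : Fin n} (hi : i ∉ F) (j : Fin n)
    (p : ℕ × Fin n × V) :
    pack p ∈ t (3 * l + 3) i j ↔
      p.1 = (state f L t i l).code ∧ p.2 ∈ (state f L t i l).own := by
  rw [h.pack_mem _ (by lia) i hi]
  simp [outgoing, state]

theorem pack_mem_echo {i : Fin n} (hi : i ∉ F) (j : Fin n) (e : Fin n × V) :
    pack (0, e) ∈ t 1 i j ↔ e.2 ∈ E ∧ pack (0, e) ∈ t 0 e.1 i ∧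
      ∀ w, pack (0, e.1, w) ∈ t 0 e.1 i → w = e.2 := by
  rw [h.pack_mem _ (by lia) i hi]
  simp [outgoing]

theorem pack_mem_proposal {i : Fin n} (hi : i ∉ F) (j : Fin n) (p : ℕ × Fin n × V) :
    pack p ∈ t 0 i j ↔ p = (0, i, x i) := by
  rw [h.pack_mem _ (by lia) i hi]
  simp [outgoing]

/-- A proposal that `f + 1` processes are ready for has been relayed by a quorum. -/
theorem exists_le_card_relay {l : ℕ} (hl : l < L + 1) {q : Fin n} {p : ℕ × Fin n × V}
    (hs : f + 1 ≤ #(support t (3 * l + 2) q p)) :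
    ∃ i ∉ F, n - f ≤ #(support t (3 * l + 1) i p) := by
  obtain ⟨i, hi, hiF⟩ := h.exists_correct hs
  exact ⟨i, hiF, (h.pack_mem_ready hl hiF q p).1 (by simpa using hi)⟩

/-- If all correct processes relay `p` then all see a quorum ready for `p`. -/
theorem le_card_ready {l : ℕ} (hl : l < L + 1) {p : ℕ × Fin n × V}
    (hp : ∀ i, i ∉ F → ∀ j, pack p ∈ t (3 * l + 1) i j) (q : Fin n) :
    n - f ≤ #(support t (3 * l + 2) q p) := by
  refine h.le_card_of_correct fun i hi => mem_senders.2 ?_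
  rw [h.pack_mem_ready hl hi]
  exact h.le_card_of_correct fun k hk => mem_senders.2 (hp k hk i)

theorem quorum : f + 1 ≤ n - f := by
  have := h.lt_card
  lia

/-! ### The initial broadcast. -/

theorem mem_own_zero {i j : Fin n} (hi : i ∉ F) : (i, x i) ∈ (state f L t j 0).own := by
  refine h.le_card_ready (l := 0) (by lia) (fun k hk q => ?_) j
  refine (h.pack_mem_echo hk q _).2 ⟨h.proposal_mem i hi, ?_, fun w hw => ?_⟩
  · exact (h.pack_mem_proposal hi k _).2 rfl
  · simpa using (h.pack_mem_proposal hi k _).1 hw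

theorem exists_quorum_echo {c : ℕ} {e : Fin n × V} (he : e ∈ admissible f L F t 0 c) :
    ∃ i ∉ F, n - f ≤ #(support t 1 i (0, e)) := by
  obtain ⟨q, -, hq⟩ := he
  exact h.exists_le_card_relay (l := 0) (by lia) hq

/-- Two quorums of echoes share a correct process, and it echoes only if the proposer sent it a
single value. -/
theorem admissible_zero_unique {c c' : ℕ} {j : Fin n} {v w : V}
    (hv : (j, v) ∈ admissible f L F t 0 c) (hw : (j, w) ∈ admissible f L F t 0 c') : v = w := by
  obtain ⟨i, hi, hvi⟩ := h.exists_quorum_echo hv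
  obtain ⟨k, hk, hwk⟩ := h.exists_quorum_echo hw
  obtain ⟨q, hq, hqF⟩ := h.exists_correct_inter hvi hwk
  rw [mem_inter, mem_senders, mem_senders, h.pack_mem_echo hqF, h.pack_mem_echo hqF] at hq
  exact hq.2.2.2 v hq.1.2.1

theorem admissible_zero_mem {c : ℕ} {e : Fin n × V} (he : e ∈ admissible f L F t 0 c) :
    e.2 ∈ E := by
  obtain ⟨i, hi, hvi⟩ := h.exists_quorum_echo he
  obtain ⟨q, hq, hqF⟩ := h.exists_correct (h.quorum.trans hvi)
  rw [mem_senders, h.pack_mem_echo hqF] at hq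
  exact hq.1

theorem own_zero_subset {i q : Fin n} (c : ℕ) :
    (state f L t i 0).own ⊆ (state f L t q 0).legit c :=
  fun _ he => h.lt_card_support (r := 2) (by lia) q he

theorem admissible_zero_eq {c : ℕ} {e : Fin n × V} (he : e ∈ admissible f L F t 0 c)
    (hF : e.1 ∉ F) : e.2 = x e.1 :=
  h.admissible_zero_unique he (c' := 0)
    ⟨e.1, hF, h.own_zero_subset (i := e.1) 0 (h.mem_own_zero hF)⟩

theorem injOn_admissible_zero (c : ℕ) : Set.InjOn Prod.fst (admissible f L F t 0 c) := by
  rintro ⟨j, v⟩ hv ⟨k, w⟩ hw hjk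
  obtain rfl : j = k := hjk
  rw [h.admissible_zero_unique hv hw]

theorem finite_admissible_zero (c : ℕ) : (admissible f L F t 0 c).Finite :=
  Set.Finite.of_finite_image (Set.toFinite _) (h.injOn_admissible_zero c)

theorem ncard_admissible_zero_le (c : ℕ) : (admissible f L F t 0 c).ncard ≤ n := by
  rw [← (h.injOn_admissible_zero c).ncard_image]
  simpa using Set.ncard_le_ncard (Set.subset_univ (Prod.fst '' admissible f L F t 0 c))
    Set.finite_univ

theorem le_ncard_own_zero (i : Fin n) : n - f ≤ (state f L t i 0).own.ncard := by
  have h1 : (fun j => (j, x j)) '' {j | j ∉ F} ⊆ (state f L t i 0).own := by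
    rintro _ ⟨j, hj, rfl⟩
    exact h.mem_own_zero hj
  have h2 := Set.ncard_le_ncard h1 (finite_own_stateAt (by have := h.lt_card; lia) _ _ _)
  rw [Set.ncard_image_of_injective _ fun a b hab => (Prod.ext_iff.1 hab).1] at h2
  have h3 : {j | j ∉ F} = ((Fᶜ : Finset (Fin n)) : Set (Fin n)) := by ext; simp
  rw [h3, Set.ncard_coe_finset, card_compl, Fintype.card_fin] at h2
  have := h.card_le
  lia

/-! ### One level of classification. -/

/-- The proposals that process `i` sees in its group at level `l`. -/
def seenAt (f L : ℕ) (t : Traffic n V) (l : ℕ) (i : Fin n) : Set (Fin n × V) :=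
  seen f (state f L t i l) fun j => t (3 * l + 5) j i

theorem mem_admissible_of_relay {l : ℕ} (hl : l < L) {c : ℕ} {e : Fin n × V} {q : Fin n}
    (hs : f + 1 ≤ #(support t (3 * l + 4) q (c, e))) : e ∈ admissible f L F t l c := by
  obtain ⟨i, hi, hiF⟩ := h.exists_correct hs
  rw [mem_senders, h.pack_mem_relay hl hiF] at hi
  exact ⟨i, hiF, hi.1⟩

theorem mem_admissible_of_ready {l : ℕ} (hl : l < L) {c : ℕ} {e : Fin n × V} {q : Fin n}
    (hs : f + 1 ≤ #(support t (3 * l + 5) q (c, e))) : e ∈ admissible f L F t l c := by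
  obtain ⟨i, -, hi⟩ := h.exists_le_card_relay (l := l + 1) (by lia) hs
  exact h.mem_admissible_of_relay hl (h.quorum.trans hi)

/-- Both kinds of evidence go back to a correct process that relayed the proposal in the parent
group `c / 2`, and it relays only what it considers admissible there. -/
theorem admissible_succ_subset {l : ℕ} (hl : l < L) (c : ℕ) :
    admissible f L F t (l + 1) c ⊆ admissible f L F t l (c / 2) := by
  rintro e ⟨q, -, hq⟩
  simp only [state, stateAt, nextState] at hq
  split_ifs at hq
  · exact h.mem_admissible_of_relay hl hq
  · exact h.mem_admissible_of_ready hl (h.quorum.trans hq)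

theorem seenAt_subset {l : ℕ} (hl : l < L) (i : Fin n) :
    seenAt f L t l i ⊆ admissible f L F t l (state f L t i l).code :=
  fun _ he => h.mem_admissible_of_ready hl he

/-- Everything that is admissible in the lower half of a group was seen by all its members. -/
theorem admissible_lower_subset {l : ℕ} (hl : l < L) (i : Fin n) :
    admissible f L F t (l + 1) (2 * (state f L t i l).code) ⊆ seenAt f L t l i := by
  rintro e ⟨q, -, hq⟩
  have h2 : ¬ 2 * (state f L t i l).code % 2 = 1 := by lia
  simp only [state, stateAt, nextState] at hq h2
  rw [if_neg h2, Nat.mul_div_cancel_left _ (by lia)] at hq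
  exact h.lt_card_support (r := 3 * l + 5) (by lia) i hq

/-- If all correct processes consider the proposals of `i` admissible in its group then all
see a quorum ready for them. -/
theorem le_card_ready_own {l : ℕ} (hl : l < L) {i : Fin n} (hi : i ∉ F)
    (hown : ∀ q, q ∉ F → (state f L t i l).own ⊆ (state f L t q l).legit (state f L t i l).code)
    {e : Fin n × V} (he : e ∈ (state f L t i l).own) (q : Fin n) :
    n - f ≤ #(support t (3 * l + 5) q ((state f L t i l).code, e)) :=
  h.le_card_ready (l := l + 1) (by lia) (fun k hk j => (h.pack_mem_relay hl hk j _).2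
    ⟨hown k hk he, i, (h.pack_mem_own hl hi k _).2 ⟨rfl, he⟩⟩) q

end counting

/-! ### The invariants. -/

/-- The invariants of the classification after `l` levels. -/
structure Invariant (f L : ℕ) (F : Finset (Fin n)) (x : Fin n → V) (t : Traffic n V) (l : ℕ) :
    Prop where
  own_subset : ∀ i, i ∉ F → ∀ q, q ∉ F →
    (state f L t i l).own ⊆ (state f L t q l).legit (state f L t i l).code
  lower : ∀ i, i ∉ F →
    n - f - 1 + (state f L t i l).code * 2 ^ (L - l) < (state f L t i l).own.ncard
  upper : ∀ i, i ∉ F → (admissible f L F t l (state f L t i l).code).ncard ≤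
    n - f - 1 + ((state f L t i l).code + 1) * 2 ^ (L - l)
  mono : ∀ i, i ∉ F → ∀ j, j ∉ F → (state f L t i l).code < (state f L t j l).code →
    admissible f L F t l (state f L t i l).code ⊆ (state f L t j l).own
  admissible_subset : ∀ c, admissible f L F t l c ⊆ admissible f L F t 0 0
  self_mem : ∀ i, i ∉ F → (i, x i) ∈ (state f L t i l).own

theorem invariant_zero (h : IsRun E f L F x t) (hL : f < 2 ^ L) : Invariant f L F x t 0 where
  own_subset i _ q _ := h.own_zero_subset _
  lower i _ := by
    have h1 := h.le_ncard_own_zero i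
    have h2 := h.quorum
    have h3 : (state f L t i 0).code = 0 := rfl
    rw [h3]
    lia
  upper i _ := by
    have h1 := h.ncard_admissible_zero_le (state f L t i 0).code
    have h2 := h.quorum
    have h3 : (state f L t i 0).code = 0 := rfl
    rw [h3] at h1 ⊢
    simp only [Nat.sub_zero]
    lia
  mono i _ j _ hij := absurd hij (lt_irrefl 0)
  admissible_subset c := subset_rfl
  self_mem i hi := h.mem_own_zero hi

/-- A process either goes to the lower half of its group or to the upper half. -/
theorem state_succ (f L : ℕ) (t : Traffic n V) (i : Fin n) (l : ℕ) :
    ((seenAt f L t l i).ncard ≤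
        n - f - 1 + (2 * (state f L t i l).code + 1) * 2 ^ (L - (l + 1)) ∧
      (state f L t i (l + 1)).code = 2 * (state f L t i l).code ∧
      (state f L t i (l + 1)).own = (state f L t i l).own) ∨
    (n - f - 1 + (2 * (state f L t i l).code + 1) * 2 ^ (L - (l + 1)) <
        (seenAt f L t l i).ncard ∧
      (state f L t i (l + 1)).code = 2 * (state f L t i l).code + 1 ∧
      (state f L t i (l + 1)).own = seenAt f L t l i) := by
  by_cases hc : (seenAt f L t l i).ncard ≤
      n - f - 1 + (2 * (state f L t i l).code + 1) * 2 ^ (L - (l + 1))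
  · exact .inl ⟨hc, if_pos hc, if_pos hc⟩
  · exact .inr ⟨not_le.1 hc, if_neg hc, if_neg hc⟩

theorem legit_lower (f L : ℕ) (t : Traffic n V) (q : Fin n) (l c : ℕ) :
    (state f L t q (l + 1)).legit (2 * c) =
      {e | n - f ≤ #(support t (3 * l + 5) q (c, e))} := by
  have h2 : ¬ 2 * c % 2 = 1 := by lia
  simp [state, stateAt, nextState]

theorem legit_upper (f L : ℕ) (t : Traffic n V) (q : Fin n) (l c : ℕ) :
    (state f L t q (l + 1)).legit (2 * c + 1) =
      {e | f + 1 ≤ #(support t (3 * l + 4) q (c, e))} := by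
  have h2 : (2 * c + 1) % 2 = 1 := by lia
  have h3 : (2 * c + 1) / 2 = c := by lia
  simp [state, stateAt, nextState, h2, h3]

theorem invariant_succ (h : IsRun E f L F x t) {l : ℕ} (hl : l < L)
    (hI : Invariant f L F x t l) : Invariant f L F x t (l + 1) := by
  have hpow : 2 ^ (L - l) = 2 * 2 ^ (L - (l + 1)) := by
    rw [← pow_succ']
    congr 1
    lia
  -- All correct processes relay the pairs held by a correct member, so it sees them itself and
  -- loses nothing by adopting what it saw.
  have hsub : ∀ i ∉ F, (state f L t i l).own ⊆ (state f L t i (l + 1)).own := by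
    intro i hi
    obtain ⟨-, -, ho⟩ | ⟨-, -, ho⟩ := state_succ f L t i l
    · rw [ho]
    · rw [ho]
      exact fun e he => h.quorum.trans (h.le_card_ready_own hl hi (hI.own_subset i hi) he i)
  have hfin : ∀ c, (admissible f L F t l c).Finite :=
    fun c => (h.finite_admissible_zero 0).subset (hI.admissible_subset c)
  have hhalf : ∀ i, (state f L t i (l + 1)).code / 2 = (state f L t i l).code := by
    intro i
    obtain ⟨-, hc, -⟩ | ⟨-, hc, -⟩ := state_succ f L t i l <;> lia
  refine ⟨fun i hi q hq => ?_, fun i hi => ?_, fun i hi => ?_, fun i hi j hj hij => ?_, fun c => ?_,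
    fun i hi => hsub i hi (hI.self_mem i hi)⟩
  · obtain ⟨-, hc, ho⟩ | ⟨-, hc, ho⟩ := state_succ f L t i l
    · rw [hc, ho, legit_lower]
      exact fun e he => h.le_card_ready_own hl hi (hI.own_subset i hi) he q
    · rw [hc, ho, legit_upper]
      intro e he
      obtain ⟨k, -, hk⟩ := h.exists_le_card_relay (l := l + 1) (by lia) he
      exact h.lt_card_support (by lia) q hk
  · obtain ⟨-, hc, ho⟩ | ⟨hn, hc, ho⟩ := state_succ f L t i l
    · have := hI.lower i hi
      rw [hpow] at this
      rw [hc, ho]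
      convert this using 2
      ring
    · rw [hc, ho]
      exact hn
  · obtain ⟨hn, hc, ho⟩ | ⟨-, hc, ho⟩ := state_succ f L t i l
    · rw [hc]
      -- The pairs admissible in the lower half are among those seen by `i`, which moved down
      -- because they did not exceed the midpoint.
      refine le_trans (Set.ncard_le_ncard (h.admissible_lower_subset hl i) ?_) hn
      exact (hfin _).subset (h.seenAt_subset hl i)
    · have h1 := Set.ncard_le_ncard (h.admissible_succ_subset hl (state f L t i (l + 1)).code)
        (hfin _)
      rw [hhalf] at h1
      refine h1.trans ((hI.upper i hi).trans (le_of_eq ?_))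
      rw [hc, hpow]
      ring
  · have hle : (state f L t i l).code ≤ (state f L t j l).code := by
      rw [← hhalf i, ← hhalf j]
      lia
    obtain hlt | heq := hle.lt_or_eq
    · refine (h.admissible_succ_subset hl _).trans ?_
      rw [hhalf]
      exact (hI.mono i hi j hj hlt).trans (hsub j hj)
    -- Within one former group, `hij` leaves only the case that `i` moved down and `j` moved up,
    -- adopting all it saw.
    · obtain ⟨-, hci, -⟩ | ⟨-, hci, -⟩ := state_succ f L t i l <;>
      obtain ⟨-, hcj, hoj⟩ | ⟨-, hcj, hoj⟩ := state_succ f L t j l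
      · lia
      · rw [hci, hoj, heq]
        exact h.admissible_lower_subset hl j
      · lia
      · lia
  · exact (h.admissible_succ_subset hl c).trans (hI.admissible_subset _)

theorem invariant (h : IsRun E f L F x t) (hL : f < 2 ^ L) {l : ℕ} (hl : l ≤ L) :
    Invariant f L F x t l := by
  induction l with
  | zero => exact h.invariant_zero hL
  | succ l ih => exact h.invariant_succ hl (ih (by lia))

theorem own_subset_admissible {l : ℕ} (hI : Invariant f L F x t l) {i : Fin n} (hi : i ∉ F) :
    (state f L t i l).own ⊆ admissible f L F t l (state f L t i l).code :=
  fun _ he => ⟨i, hi, hI.own_subset i hi i hi he⟩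

/-! ### Agreement and the number of rounds. -/

/-- After all levels, the sets accumulated by the correct processes form a chain. -/
theorem own_subset_of_code_le (h : IsRun E f L F x t) (hI : Invariant f L F x t L)
    {i j : Fin n} (hi : i ∉ F) (hj : j ∉ F)
    (hij : (state f L t i L).code ≤ (state f L t j L).code) :
    (state f L t i L).own ⊆ (state f L t j L).own := by
  refine (own_subset_admissible hI hi).trans ?_
  obtain hlt | heq := hij.lt_or_eq
  · exact hI.mono i hi j hj hlt
  -- At level `L` the two bounds leave one size, so the set of `j` is the whole admissible set of
  -- the group.
  · have h1 := hI.lower j hj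
    have h2 := hI.upper j hj
    simp only [Nat.sub_self, pow_zero, mul_one] at h1 h2
    rw [heq, Set.eq_of_subset_of_ncard_le (own_subset_admissible hI hj) (by lia)
      ((h.finite_admissible_zero 0).subset (hI.admissible_subset _))]

theorem isLatticeAgreement [SemilatticeSup V] (h : IsRun E f L F x t) (hL : f < 2 ^ L) :
    IsLatticeAgreement E f F x fun i => joinD (state f L t i L).own (x i) := by
  have hI := h.invariant hL le_rfl
  have hsub : ∀ i ∉ F, (state f L t i L).own ⊆ admissible f L F t 0 0 :=
    fun i hi => (own_subset_admissible hI hi).trans (hI.admissible_subset _)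
  have hlub : ∀ i ∉ F,
      IsLUB (Prod.snd '' (state f L t i L).own) (joinD (state f L t i L).own (x i)) :=
    fun i hi => isLUB_joinD ((h.finite_admissible_zero 0).subset (hsub i hi))
      ⟨_, hI.self_mem i hi⟩ _
  refine ⟨fun i j hi hj => ?_, fun i hi => (hlub i hi).1 ⟨_, hI.self_mem i hi, rfl⟩, ?_⟩
  · obtain hij | hij := le_total (state f L t i L).code (state f L t j L).code
    · exact .inl ((hlub i hi).mono (hlub j hj)
        (Set.image_mono (h.own_subset_of_code_le hI hi hj hij)))
    · exact .inr ((hlub j hj).mono (hlub i hi)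
        (Set.image_mono (h.own_subset_of_code_le hI hj hi hij)))
  -- The foreign values number at most one per Byzantine proposer.
  · set D : Set (Fin n × V) := {e ∈ admissible f L F t 0 0 | e.1 ∈ F}
    have hDfin : D.Finite := (h.finite_admissible_zero 0).subset (Set.sep_subset _ _)
    have hB : (Prod.snd '' D).Finite := hDfin.image _
    have hne : ∃ i, i ∉ F := by
      by_contra! hc
      have h1 := h.card_le
      have h2 := h.lt_card
      rw [eq_univ_of_forall hc, card_univ, Fintype.card_fin] at h1
      lia
    obtain ⟨s, hs⟩ : ∃ s, IsLUB ({v | ∃ i, i ∉ F ∧ x i = v} ∪ (Prod.snd '' D)) s := by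
      refine exists_isLUB (Set.Finite.union ?_ hB) ?_
      · exact (Set.finite_range x).subset fun v ⟨i, _, hi⟩ => ⟨i, hi⟩
      · obtain ⟨i, hi⟩ := hne
        exact ⟨x i, .inl ⟨i, hi, rfl⟩⟩
    refine ⟨hB.toFinset, ?_, ?_, s, by simpa using hs, fun i hi => ?_⟩
    · rw [Set.Finite.coe_toFinset]
      rintro _ ⟨e, he, rfl⟩
      exact h.admissible_zero_mem he.1
    · rw [← Set.ncard_eq_toFinset_card _ hB]
      refine (Set.ncard_image_le hDfin).trans ?_
      rw [← ((h.injOn_admissible_zero 0).mono (Set.sep_subset _ _) : Set.InjOn _ D).ncard_image]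
      refine le_trans ?_ h.card_le
      rw [← Set.ncard_coe_finset]
      refine Set.ncard_le_ncard ?_ F.finite_toSet
      rintro _ ⟨e, he, rfl⟩
      exact he.2
    · refine (hlub i hi).mono hs ?_
      rintro _ ⟨e, he, rfl⟩
      by_cases heF : e.1 ∈ F
      · exact .inr ⟨e, ⟨hsub i hi he, heF⟩, rfl⟩
      · exact .inl ⟨e.1, heF, (h.admissible_zero_eq (hsub i hi he) heF).symm⟩

end IsRun

theorem solvesByzantineLA_algorithm [SemilatticeSup V] (E : Set V) {f L : ℕ} (hn : 3 * f < n)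
    (hL : f < 2 ^ L) : SolvesByzantineLA (algorithm n E f L) E f (3 * (L + 1)) := by
  intro F hF x hx t ht
  have hrun := isRun_of_isExecution hF hn hx ht
  have hlen : ∀ i r, (t.history i r).length = r := by simp [Traffic.history]
  have hstate : ∀ i, stateAt f L (inboxes (t.history i (3 * (L + 1)))) L =
      IsRun.state f L t i L :=
    fun i => stateAt_congr f L L fun r hr => inboxes_history t i (by lia)
  refine ⟨fun r hr i hi j => ?_, _, fun i hi => ⟨_, le_rfl, ?_⟩, fun i hi r v hv => ?_,
    hrun.isLatticeAgreement hL⟩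
  · rw [ht.correct r i hi j]
    simp [algorithm, hlen, not_lt.2 hr]
  · simp [algorithm, hlen, hstate]
  · simp only [algorithm, hlen] at hv
    split_ifs at hv with hr
    subst hr
    rw [hstate] at hv
    exact (Option.some.inj hv).symm

theorem isBigO_rounds :
    (fun f : ℕ => ((3 * (Nat.log 2 f + 1 + 1) : ℕ) : ℝ)) =O[Filter.atTop]
      (fun f : ℕ => Real.log (f : ℝ)) := by
  -- The constant comes from `3 * (k + 2) ≤ 9 * k` for `k = Nat.log 2 f ≥ 1`.
  refine Asymptotics.IsBigO.of_bound (9 / Real.log 2) ?_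
  filter_upwards [Filter.eventually_ge_atTop 2] with f hf
  have h2 : 0 < Real.log 2 := Real.log_pos (by norm_num)
  have h1 : (1 : ℝ) ≤ Nat.log 2 f := by
    exact_mod_cast Nat.log_pos (by norm_num) hf
  have h3 : (Nat.log 2 f : ℝ) * Real.log 2 ≤ Real.log f := by
    have := Real.natLog_le_logb f 2
    rwa [Real.logb, Nat.cast_ofNat, le_div_iff₀ h2] at this
  have h4 : 0 ≤ Real.log f := by nlinarith
  rw [Real.norm_of_nonneg (Nat.cast_nonneg _), Real.norm_of_nonneg h4, div_mul_eq_mul_div,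
    le_div_iff₀ h2]
  push_cast
  nlinarith

end ByzantineLA

theorem mainTheorem4 :
    ∃ T : ℕ → ℕ,
      (fun f : ℕ => (T f : ℝ)) =O[Filter.atTop] (fun f : ℕ => Real.log (f : ℝ)) ∧
      ∀ n f : ℕ, 3 * f + 1 ≤ n →
        ∀ (V : Type*) [SemilatticeSup V] (E : Set V),
          ∃ A : SyncAlgorithm n V, SolvesByzantineLA A E f (T f) := by
  -- With `L = Nat.log 2 f + 1` levels, `f < 2 ^ L`; the broadcast and each level take three rounds.
  refine ⟨fun f => 3 * (Nat.log 2 f + 1 + 1), ByzantineLA.isBigO_rounds, ?_⟩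
  intro n f hn V _ E
  exact ⟨ByzantineLA.algorithm n E f (Nat.log 2 f + 1),
    ByzantineLA.solvesByzantineLA_algorithm E (by lia) (Nat.lt_pow_succ_log_self (by lia) f)⟩
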